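/- Let $\Sigma$ be a finite alphabet. All automata are deterministic and complete, with a finite state set $Q$, an initial state and a transition function $\delta:Q\times\Sigma\to Q$; the run on $x\in\Sigma^\omega$ is the induced infinite sequence of states. A DBW (deterministic Büchi word automaton) has a set $\alpha\subseteq Q$ and accepts $x$ iff the run on $x$ visits $\alpha$ infinitely often. A DPW (deterministic parity word automaton) has a colouring $\alpha:Q\to\{0,\dots,k\}$ for some $k\ge 0$ and accepts $x$ iff the maximal colour visited infinitely often by the run on $x$ is odd. $L(\mathcal A)$ denotes the set of words that $\mathcal A$ accepts. For $L_1,L_2\subseteq\Sigma^\omega$, a *DBW-sep-refuter for $\langle L_1,L_2\rangle$* is a finite-state transducer $\mathcal R=\langle S,s_0,\rho,\tau\rangle$ with $s_0\in S$, $\rho:S\times\{\mathrm{acc},\mathrm{rej}\}\to S$ and $\tau:S\to\Sigma$ such that for every $y=y_0y_1y_2\cdots\in\{\mathrm{acc},\mathrm{rej}\}^\omega$, writing $s_{j+1}=\rho(s_j,y_j)$ for $j\ge 0$, the output word $x=\tau(s_1)\tau(s_2)\tau(s_3)\cdots$ (the label of $s_0$ is ignored) satisfies: either $x\in L_1$ and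 $y$ has only finitely many $\mathrm{acc}$'s, or $x\in L_2$ and $y$ has infinitely many $\mathrm{acc}$'s. **Theorem.** Let $\mathcal A_1$ and $\mathcal A_2$ be DPWs over $\Sigma$ with $n_1$ and $n_2$ states, respectively, and let $L_1=L(\mathcal A_1)$ and $L_2=L(\mathcal A_2)$. At least one of the following holds. 1. There is a DBW $\mathcal A$ with $2\cdot n_1\cdot n_2$ states such that $L_1\subseteq L(\mathcal A)$ and $L_2\cap L(\mathcal A)=\emptyset$. 2. There is a DBW-sep-refuter for $\langle L_1,L_2\rangle$ with $2\cdot n_1\cdot n_2$ states. -/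

import Mathlib

open Filter

namespace OmegaAut

universe u v

/-- An infinite word over the alphabet `B`, i.e. an element of `B^ω`. -/
abbrev Word (B : Type u) := ℕ → B

/-- A language of infinite words over `B`. -/
abbrev Lang (B : Type u) := Set (Word B)

/-- The merge `x ⊕ y = (x₀,y₀)(x₁,y₁)(x₂,y₂)⋯` of two words. -/
def merge {B : Type u} {A : Type v} (x : Word B) (y : Word A) : Word (B × A) :=
  fun i => (x i, y i)

/-- The run `q₀, δ(q₀,x₀), δ(δ(q₀,x₀),x₁), …` of a deterministic transition function on `x`. -/
def runFrom {B : Type u} {Q : Type v} (δ : Q → B → Q) (q₀ : Q) (x : Word B) : ℕ → Q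
  | 0 => q₀
  | i + 1 => δ (runFrom δ q₀ x i) (x i)

/-- `inf(r)`: the set of states that the sequence `r` visits infinitely often. -/
def infSet {Q : Type v} (r : ℕ → Q) : Set Q := {q | ∃ᶠ i in atTop, r i = q}

/-- A deterministic Büchi word automaton over the alphabet `B` with state space `Q`. -/
structure DBW (B : Type u) (Q : Type v) where
  start : Q
  step : Q → B → Q
  acc : Set Q

/-- The language of a DBW: the run visits `acc` infinitely often. -/
def DBW.language {B : Type u} {Q : Type v} (D : DBW B Q) : Lang B :=
  {x | (D.acc ∩ infSet (runFrom D.step D.start x)).Nonempty}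

/-- A deterministic parity word automaton over the alphabet `B` with state space `Q`.
The colours are natural numbers; as `Q` is finite in all uses, they lie in some `{0, …, k}`. -/
structure DPW (B : Type u) (Q : Type v) where
  start : Q
  step : Q → B → Q
  color : Q → ℕ

/-- The language of a DPW: the maximal colour that is visited infinitely often is odd. -/
def DPW.language {B : Type u} {Q : Type v} (P : DPW B Q) : Lang B :=
  {x | ∃ c, IsGreatest (P.color '' infSet (runFrom P.step P.start x)) c ∧ Odd c}

/-- Who initiates the interaction modelled by a transducer. -/
inductive Initiator
  | sys
  | env

/-- An `(I/O)`-transducer with state space `S`: it reads letters in `I`, and its states are labelled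
by output letters in `O`. -/
structure Transducer (I : Type u) (O : Type v) (S : Type*) where
  init : Initiator
  start : S
  step : S → I → S
  out : S → O

/-- The annotation `T(x)` of the input word `x`. With `s₀, s₁, s₂, …` the run on `x`, it is
`τ(s₀)τ(s₁)τ(s₂)⋯` if the system initiates the interaction, and `τ(s₁)τ(s₂)τ(s₃)⋯` if the
environment does. -/
def Transducer.annotation {I : Type u} {O : Type v} {S : Type*} (T : Transducer I O S)
    (x : Word I) : Word O :=
  match T.init with
  | Initiator.sys => fun i => T.out (runFrom T.step T.start x i)
  | Initiator.env => fun i => T.out (runFrom T.step T.start x (i + 1))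

/-- The annotations used for Büchi automata. -/
inductive Ann
  | acc
  | rej

/-- The words over `{acc, rej}` with infinitely many `acc`. -/
def infAcc : Lang Ann := {y | ∃ᶠ i in atTop, y i = Ann.acc}

/-- The words `x ⊕ y` in which `y` is a correct annotation for separating `L₁` from `L₂`. -/
def DBWSep {B : Type u} (L₁ L₂ : Lang B) : Lang (B × Ann) :=
  {w | ∃ (x : Word B) (y : Word Ann), w = merge x y ∧
    (x ∈ L₁ → y ∈ infAcc) ∧ (x ∈ L₂ → y ∉ infAcc)}

/-- The words `x ⊕ y` in which `y` is an incorrect annotation for separating `L₁` from `L₂`. -/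
def NoDBWSep {B : Type u} (L₁ L₂ : Lang B) : Lang (B × Ann) :=
  {w | ∃ (x : Word B) (y : Word Ann), w = merge x y ∧
    ((x ∈ L₁ ∧ y ∉ infAcc) ∨ (x ∈ L₂ ∧ y ∈ infAcc))}

theorem merge_inj {B : Type u} {A : Type v} {x x' : Word B} {y y' : Word A}
    (h : merge x y = merge x' y') : x = x' ∧ y = y' :=
  ⟨funext fun i => congrArg Prod.fst (congrFun h i),
    funext fun i => congrArg Prod.snd (congrFun h i)⟩

/-- Incorrect annotations are exactly the complement of the correct ones. -/
theorem compl_DBWSep {B : Type u} (L₁ L₂ : Lang B) : (DBWSep L₁ L₂)ᶜ = NoDBWSep L₁ L₂ := by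
  ext w
  constructor
  · intro h
    refine ⟨fun i => (w i).1, fun i => (w i).2, rfl, ?_⟩
    by_contra hc
    refine h ⟨fun i => (w i).1, fun i => (w i).2, rfl, ?_⟩
    tauto
  · rintro ⟨x, y, rfl, h⟩ ⟨x', y', he, h'⟩
    obtain ⟨rfl, rfl⟩ := merge_inj he
    tauto

/-- `T` is a DBW-sep-refuter for `⟨L₁, L₂⟩`: an `(A/Σ)`-transducer, with `A = {acc, rej}`, in which
the environment initiates the interaction and which realizes `NoDBWSep L₁ L₂`. -/
def IsDBWSepRefuter {B : Type u} {S : Type*} (T : Transducer Ann B S) (L₁ L₂ : Lang B) : Prop :=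
  T.init = Initiator.env ∧ ∀ y : Word Ann, merge (T.annotation y) y ∈ NoDBWSep L₁ L₂

/-- `L` is a separator for `⟨L₁, L₂⟩`. -/
def IsSeparator {B : Type u} (L L₁ L₂ : Lang B) : Prop := L₁ ⊆ L ∧ L₂ ∩ L = ∅

end OmegaAut

namespace OmegaAut

open Relation

/-! ### Limit sets and loops of a finite transition graph. -/

section Runs

variable {B Q R : Type*}

/-! Everything takes place in the product graph of the two automata, where limit sets of runs are
loops (`isLoop_infSet`). Call a loop 2-odd if its greatest `A₂`-colour is odd. The candidate DBW
accepts by visiting infinitely often a vertex that lies on no 2-odd loop. It rejects every word of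
`L₂`, whose limit set is itself a 2-odd loop.

If it also rejects some `x ∈ L₁`, each vertex of the limit set `S` of `x` lies on a 2-odd loop. The
union of these loops is a 2-odd loop `T ⊇ S`, since the greatest of odd maxima is odd
(`IsLoop.exists_superset`). The refuter exploits `S ⊆ T` (`exists_refuter_of_loop`). Let `s₁ ∈ S`
and `s₂ ∈ T` have the greatest `A₁`-colour in `S` and the greatest `A₂`-colour in `T`. Each `acc`
triggers a trip to `s₂` within `T`; otherwise the run heads for `s₁` and then stays in `S`.
Infinitely many `acc`'s give a word of `L₂`, finitely many a word of `L₁`. One bit records whether a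
trip is pending, hence the factor 2. -/

theorem infSet_comp [Finite Q] (f : Q → R) (r : ℕ → Q) :
    infSet (fun i => f (r i)) = f '' infSet r := by
  ext x
  constructor
  · intro hx
    by_contra hc
    have h : ∀ q, ∀ᶠ i in atTop, ¬ (r i = q ∧ f q = x) := by
      intro q
      by_cases hq : f q = x
      · have : ¬ ∃ᶠ i in atTop, r i = q := fun h' => hc ⟨q, h', hq⟩
        filter_upwards [not_frequently.1 this] with i hi h
        exact hi h.1
      · exact Eventually.of_forall fun i h => hq h.2
    refine hx ?_
    filter_upwards [eventually_all.2 h] with i hi h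
    exact hi (r i) ⟨rfl, h⟩
  · rintro ⟨q, hq, rfl⟩
    exact Frequently.mono hq fun i hi => congrArg f hi

theorem eventually_mem_infSet [Finite Q] (r : ℕ → Q) : ∀ᶠ i in atTop, r i ∈ infSet r := by
  have h : ∀ q, ∀ᶠ i in atTop, r i = q → q ∈ infSet r := by
    intro q
    by_cases hq : q ∈ infSet r
    · exact Eventually.of_forall fun i _ => hq
    · filter_upwards [not_frequently.1 hq] with i hi h
      exact absurd h hi
  filter_upwards [eventually_all.2 h] with i hi
  exact hi _ rfl

/-- A sequence that eventually stays in `S` has its limit set in `S`. -/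
theorem infSet_subset {r : ℕ → Q} {S : Set Q} (h : ∀ᶠ i in atTop, r i ∈ S) : infSet r ⊆ S := by
  intro q hq
  obtain ⟨i, hi, hS⟩ := (Frequently.and_eventually hq h).exists
  exact hi ▸ hS

/-- The edges of the transition graph between vertices of `S`. -/
def stepIn (δ : Q → B → Q) (S : Set Q) (p q : Q) : Prop := p ∈ S ∧ q ∈ S ∧ ∃ b, δ p b = q

/-- `S` is strongly connected, by nontrivial paths within `S`. -/
def IsLoop (δ : Q → B → Q) (S : Set Q) : Prop :=
  ∀ p ∈ S, ∀ q ∈ S, TransGen (stepIn δ S) p q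

theorem transGen_stepIn_mono {δ : Q → B → Q} {S T : Set Q} (h : S ⊆ T) {p q : Q}
    (hpq : TransGen (stepIn δ S) p q) : TransGen (stepIn δ T) p q :=
  TransGen.mono (r := stepIn δ S) (p := stepIn δ T)
    (fun _ _ h' => ⟨h h'.1, h h'.2.1, h'.2.2⟩) p q hpq

theorem transGen_runFrom {δ : Q → B → Q} {q₀ : Q} {x : Word B} {S : Set Q} {i j : ℕ}
    (hij : i < j) (hS : ∀ k, i ≤ k → runFrom δ q₀ x k ∈ S) :
    TransGen (stepIn δ S) (runFrom δ q₀ x i) (runFrom δ q₀ x j) := by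
  have key : ∀ k, i ≤ k → stepIn δ S (runFrom δ q₀ x k) (runFrom δ q₀ x (k + 1)) :=
    fun k hk => ⟨hS k hk, hS _ (by omega), x k, rfl⟩
  induction j, hij using Nat.le_induction with
  | base => exact TransGen.single (key i le_rfl)
  | succ j hj ih => exact ih.tail (key j (by omega))

theorem isLoop_infSet [Finite Q] (δ : Q → B → Q) (q₀ : Q) (x : Word B) :
    IsLoop δ (infSet (runFrom δ q₀ x)) := by
  intro p hp q hq
  obtain ⟨N, hN⟩ := eventually_atTop.1 (eventually_mem_infSet (runFrom δ q₀ x))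
  obtain ⟨i, hi, rfl⟩ := frequently_atTop.1 hp N
  obtain ⟨j, hj, rfl⟩ := frequently_atTop.1 hq (i + 1)
  exact transGen_runFrom hj fun k hk => hN k (hi.trans hk)

/-- If every vertex of the loop `S` lies on a loop whose greatest colour is odd, then `S` is
contained in a single loop whose greatest colour is odd. -/
theorem IsLoop.exists_superset [Finite Q] {δ : Q → B → Q} {S : Set Q} (hS : IsLoop δ S)
    (hne : S.Nonempty) {c : Q → ℕ}
    (h : ∀ q ∈ S, ∃ T, IsLoop δ T ∧ q ∈ T ∧ ∃ k, IsGreatest (c '' T) k ∧ Odd k) :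
    ∃ T, S ⊆ T ∧ IsLoop δ T ∧ ∃ k, IsGreatest (c '' T) k ∧ Odd k := by
  choose! T hT hmem k hk hodd using h
  have hsub : ∀ q ∈ S, T q ⊆ ⋃ q ∈ S, T q := fun q hq => Set.subset_biUnion_of_mem hq
  have hSsub : S ⊆ ⋃ q ∈ S, T q := fun q hq => hsub q hq (hmem q hq)
  refine ⟨⋃ q ∈ S, T q, hSsub, ?_, ?_⟩
  · intro p hp q hq
    obtain ⟨p', hp', hp⟩ := Set.mem_iUnion₂.1 hp
    obtain ⟨q', hq', hq⟩ := Set.mem_iUnion₂.1 hq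
    exact ((transGen_stepIn_mono (hsub p' hp') (hT p' hp' p hp p' (hmem p' hp'))).trans
      (transGen_stepIn_mono hSsub (hS p' hp' q' hq'))).trans
      (transGen_stepIn_mono (hsub q' hq') (hT q' hq' q' (hmem q' hq') q hq))
  -- The greatest colour of the union is the greatest of the maxima `k q`, all of which are odd.
  · obtain ⟨q, hq, hmax⟩ := Set.exists_max_image S k S.toFinite hne
    refine ⟨k q, ⟨Set.image_mono (hsub q hq) (hk q hq).1, ?_⟩, hodd q hq⟩
    rintro _ ⟨p, hp, rfl⟩
    obtain ⟨p', hp', hp⟩ := Set.mem_iUnion₂.1 hp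
    exact ((hk p' hp').2 ⟨p, hp, rfl⟩).trans (hmax p' hp')

theorem isGreatest_image_of_subset {c : Q → ℕ} {S T : Set Q} {q : Q} (hq : q ∈ S)
    (hST : S ⊆ T) (h : c q ∈ upperBounds (c '' T)) : IsGreatest (c '' S) (c q) :=
  ⟨⟨q, hq, rfl⟩, fun _ hk => h (Set.image_mono hST hk)⟩

end Runs

/-! ### Positional steering and the one-bit strategy. -/

section Steering

variable {B Q : Type*}

/-- Choosing letters by `g` keeps the run in `S`, and the rank `d` decreases until `t` is reached. -/
def Steers (δ : Q → B → Q) (t : Q) (S : Set Q) (g : Q → B) (d : Q → ℕ) : Prop :=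
  ∀ q ∈ S, δ q (g q) ∈ S ∧ (δ q (g q) = t ∨ d (δ q (g q)) < d q)

/-- There is an `R`-path of length `n + 1` to `t`. -/
def pathTo (R : Q → Q → Prop) (t : Q) : ℕ → Q → Prop
  | 0, q => R q t
  | n + 1, q => ∃ q', R q q' ∧ pathTo R t n q'

theorem exists_pathTo {R : Q → Q → Prop} {t q : Q} (h : TransGen R q t) : ∃ n, pathTo R t n q := by
  induction h using TransGen.head_induction_on with
  | single h => exact ⟨0, h⟩
  | head h _ ih =>
    obtain ⟨n, hn⟩ := ih
    exact ⟨n + 1, _, h, hn⟩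

theorem exists_steers [Nonempty B] {δ : Q → B → Q} {t : Q} {S : Set Q}
    (h : ∀ q ∈ S, TransGen (stepIn δ S) q t) : ∃ g d, Steers δ t S g d := by
  -- The rank is one less than the length of a shortest nontrivial path to `t` inside `S`; following
  -- such a path lowers it.
  let d : Q → ℕ := fun q => sInf {n | pathTo (stepIn δ S) t n q}
  have key : ∀ q ∈ S, ∃ b, δ q b ∈ S ∧ (δ q b = t ∨ d (δ q b) < d q) := by
    intro q hq
    have hd : pathTo (stepIn δ S) t (d q) q := Nat.sInf_mem (exists_pathTo (h q hq))
    rcases hn : d q with _ | n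
    · rw [hn] at hd
      obtain ⟨-, h₂, b, rfl⟩ := hd
      exact ⟨b, h₂, Or.inl rfl⟩
    · rw [hn] at hd
      obtain ⟨q', ⟨-, h₂, b, rfl⟩, hq'⟩ := hd
      exact ⟨b, h₂, Or.inr (Nat.lt_succ_of_le (Nat.sInf_le hq'))⟩
  choose! g hg using key
  exact ⟨g, d, hg⟩

open Classical in
/-- A steering on a subset takes precedence over a steering on the whole set. -/
theorem Steers.piecewise [Finite Q] {δ : Q → B → Q} {t : Q} {S T : Set Q} {g g' : Q → B}
    {d d' : Q → ℕ} (h : Steers δ t S g d) (h' : Steers δ t T g' d') (hST : S ⊆ T) :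
    ∃ d'', Steers δ t T (S.piecewise g g') d'' := by
  obtain ⟨M, hM⟩ := (Set.finite_range d).bddAbove
  have hM : ∀ q, d q ≤ M := fun q => hM ⟨q, rfl⟩
  -- The offset `M + 1` ranks every state outside `S` above all states of `S`, so entering `S` also
  -- lowers the rank.
  refine ⟨S.piecewise d fun q => M + 1 + d' q, fun q hq => ?_⟩
  by_cases hS : q ∈ S
  · obtain ⟨h₁, h₂⟩ := h q hS
    rw [Set.piecewise_eq_of_mem _ g g' hS, Set.piecewise_eq_of_mem _ _ _ hS,
      Set.piecewise_eq_of_mem _ _ _ h₁]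
    exact ⟨hST h₁, h₂⟩
  · obtain ⟨h₁, h₂⟩ := h' q hq
    rw [Set.piecewise_eq_of_notMem _ g g' hS, Set.piecewise_eq_of_notMem _ _ _ hS]
    refine ⟨h₁, h₂.imp_right fun h₂ => ?_⟩
    by_cases hS' : δ q (g' q) ∈ S
    · rw [Set.piecewise_eq_of_mem _ _ _ hS']
      have := hM (δ q (g' q))
      omega
    · rw [Set.piecewise_eq_of_notMem _ _ _ hS']
      omega

theorem exists_visit {q : ℕ → Q} {t : Q} {P : ℕ → Prop} {d : Q → ℕ}
    (h : ∀ i, P i → q (i + 1) = t ∨ (P (i + 1) ∧ d (q (i + 1)) < d (q i))) {i : ℕ} (hi : P i) :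
    ∃ j, i < j ∧ q j = t := by
  induction hn : d (q i) using Nat.strong_induction_on generalizing i with
  | _ n ih =>
    rcases h i hi with h | ⟨h₁, h₂⟩
    · exact ⟨i + 1, by omega, h⟩
    · obtain ⟨j, hj, ht⟩ := ih _ (hn ▸ h₂) h₁ rfl
      exact ⟨j, by omega, ht⟩

open Classical in
/-- A letter-choosing strategy with one bit of memory: the bit selects one of two targets, it is set
by `acc`, and cleared when `t` is reached. -/
noncomputable def modeStep (δ : Q → B → Q) (t : Q) (g : Bool → Q → B) (s : Q × Bool) (a : Ann) :
    Q × Bool :=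
  (δ s.1 (g s.2 s.1), decide (a = Ann.acc ∨ (s.2 = true ∧ δ s.1 (g s.2 s.1) ≠ t)))

section

variable {δ : Q → B → Q} {s₁ s₂ : Q} {S T U : Set Q} {g : Bool → Q → B} {s : ℕ → Q × Bool}
  {y : Word Ann}

/-- A bit set by `acc` stays set until `s₂` is reached, so `s₂` recurs; from the first visit on, the
run is trapped in `T`, which both modes preserve. -/
theorem mode_infAcc {d : Q → ℕ} (hs : ∀ i, s (i + 1) = modeStep δ s₂ g (s i) (y i))
    (hU : ∀ i, (s i).1 ∈ U) (hT : ∀ m, ∀ q ∈ T, δ q (g m q) ∈ T) (h₂ : s₂ ∈ T)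
    (hg : Steers δ s₂ U (g true) d) (hy : y ∈ infAcc) :
    s₂ ∈ infSet (fun i => (s i).1) ∧ infSet (fun i => (s i).1) ⊆ T := by
  have hvis : s₂ ∈ infSet (fun i => (s i).1) := by
    refine frequently_atTop.2 fun N => ?_
    obtain ⟨i, hi, ha⟩ := frequently_atTop.1 hy N
    have hm : (s (i + 1)).2 = true := by simp [hs, modeStep, ha]
    obtain ⟨j, hj, hq⟩ := exists_visit (q := fun i => (s i).1) (t := s₂)
      (P := fun i => (s i).2 = true) (d := d) (by
        intro i hi
        have h := (hg _ (hU i)).2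
        have h1 : (s (i + 1)).1 = δ (s i).1 (g true (s i).1) := by simp [hs, modeStep, hi]
        by_cases ht : δ (s i).1 (g true (s i).1) = s₂
        · exact Or.inl (h1.trans ht)
        · refine Or.inr ⟨by simp [hs, modeStep, hi, ht], ?_⟩
          simp only [h1]
          exact h.resolve_left ht) hm
    exact ⟨j, by omega, hq⟩
  refine ⟨hvis, infSet_subset ?_⟩
  obtain ⟨N, hN⟩ := hvis.exists
  filter_upwards [eventually_ge_atTop N] with i hi
  induction i, hi using Nat.le_induction with
  | base => exact Set.mem_of_eq_of_mem hN h₂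
  | succ i _ ih =>
    rw [hs]
    exact hT _ _ ih

theorem mode_not_infAcc {d d' : Q → ℕ} (hs : ∀ i, s (i + 1) = modeStep δ s₂ g (s i) (y i))
    (hU : ∀ i, (s i).1 ∈ U) (hS : ∀ q ∈ S, δ q (g false q) ∈ S) (h₁ : s₁ ∈ S)
    (hg : Steers δ s₂ U (g true) d) (hg' : Steers δ s₁ U (g false) d') (hy : y ∉ infAcc) :
    s₁ ∈ infSet (fun i => (s i).1) ∧ infSet (fun i => (s i).1) ⊆ S := by
  obtain ⟨N, hN⟩ := eventually_atTop.1 (not_frequently.1 hy)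
  -- With no `acc` after `N`, a bit set forever would steer the run into `s₂`, and that very step
  -- would clear it.
  have hclear : ∃ M, N ≤ M ∧ (s M).2 = false := by
    by_contra! hc
    have hc : ∀ M, N ≤ M → (s M).2 = true := fun M hM => by simpa using hc M hM
    have hstep : ∀ i, N ≤ i → (s (i + 1)).1 ≠ s₂ := by
      intro i hi ht
      have := hc (i + 1) (by omega)
      rw [hs] at ht this
      simp only [modeStep, decide_eq_true_eq] at ht this
      exact this.elim (hN i hi) fun h => h.2 ht
    obtain ⟨j, hj, hq⟩ := exists_visit (q := fun i => (s i).1) (t := s₂)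
      (P := fun i => N ≤ i) (d := d) (by
        intro i hi
        have h := (hg _ (hU i)).2
        have h1 : (s (i + 1)).1 = δ (s i).1 (g true (s i).1) := by simp [hs, modeStep, hc i hi]
        simp only [h1]
        exact h.imp_right fun h => ⟨by omega, h⟩) (le_refl N)
    obtain ⟨j, rfl⟩ : ∃ k, j = k + 1 := ⟨j - 1, by omega⟩
    exact hstep j (by omega) hq
  obtain ⟨M, hNM, hM⟩ := hclear
  have hfalse : ∀ i, M ≤ i → (s i).2 = false := by
    intro i hi
    induction i, hi using Nat.le_induction with
    | base => exact hM
    | succ i hi ih =>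
      have := hN i (by omega)
      simp [hs, modeStep, ih, this]
  have hnext : ∀ i, M ≤ i → (s (i + 1)).1 = δ (s i).1 (g false (s i).1) := by
    intro i hi
    simp [hs, modeStep, hfalse i hi]
  have hvis : ∀ i, M ≤ i → ∃ j, i < j ∧ (s j).1 = s₁ := by
    intro i hi
    refine exists_visit (q := fun i => (s i).1) (P := fun i => M ≤ i) (d := d') ?_ hi
    intro i hi
    simp only [hnext i hi]
    exact (hg' _ (hU i)).2.imp_right fun h => ⟨by omega, h⟩
  refine ⟨frequently_atTop.2 fun i => ?_, infSet_subset ?_⟩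
  · obtain ⟨j, hj, h⟩ := hvis (max i M) (le_max_right _ _)
    exact ⟨j, by omega, h⟩
  · obtain ⟨j, hj, h⟩ := hvis M le_rfl
    filter_upwards [eventually_ge_atTop j] with i hi
    induction i, hi using Nat.le_induction with
    | base => exact Set.mem_of_eq_of_mem h h₁
    | succ i hi ih =>
      rw [hnext i (by omega)]
      exact hS _ ih

end

open Classical in
/-- The strategy `modeStep` can be run by a transducer on the same states that spends its first move
on reaching a state over `q₀`. -/
theorem exists_initialized_modeStep (δ : Q → B → Q) (q₀ t : Q) (g : Bool → Q → B) :
    ∃ (start : Q × Bool) (step : Q × Bool → Ann → Q × Bool), ∀ y : Word Ann,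
      (runFrom step start y 1).1 = q₀ ∧ ∀ i, runFrom step start y (i + 2) =
        modeStep δ t g (runFrom step start y (i + 1)) (y (i + 1)) := by
  by_cases h : ∃ p m, δ p (g m p) = q₀
  · obtain ⟨p, m, h⟩ := h
    -- The label of the start state is never output, so the run may start at a predecessor of `q₀`.
    exact ⟨(p, m), modeStep δ t g, fun y => ⟨h, fun i => rfl⟩⟩
  · push Not at h
    -- No move of the strategy enters `q₀`, so `(q₀, false)` is free to serve as a start state that
    -- is never revisited.
    refine ⟨(q₀, false), fun s a => if s = (q₀, false) then (q₀, true) else modeStep δ t g s a,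
      fun y => ?_⟩
    set step : Q × Bool → Ann → Q × Bool :=
      fun s a => if s = (q₀, false) then (q₀, true) else modeStep δ t g s a with hstep
    have hne : ∀ i, runFrom step (q₀, false) y (i + 1) ≠ (q₀, false) := by
      intro i
      show step _ _ ≠ _
      rw [hstep]
      dsimp only
      split_ifs
      · simp
      · exact fun hc => h _ _ (congrArg Prod.fst hc)
    refine ⟨by simp [runFrom, hstep], fun i => ?_⟩
    exact if_neg (hne i)

end Steering

/-! ### Renaming of states. -/

section Transport

variable {A B S S' : Type*}

theorem runFrom_equiv (e : S ≃ S') (δ : S → A → S) (q : S) (x : Word A) (i : ℕ) :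
    runFrom (fun s a => e (δ (e.symm s) a)) (e q) x i = e (runFrom δ q x i) := by
  induction i with
  | zero => rfl
  | succ i ih => simp [runFrom, ih]

end Transport

/-! ### The product graph and the dichotomy. -/

section Product

variable {B Q₁ Q₂ : Type*} (A₁ : DPW B Q₁) (A₂ : DPW B Q₂)

/-- The transition function of the product of two automata. -/
def prodStep (q : Q₁ × Q₂) (b : B) : Q₁ × Q₂ := (A₁.step q.1 b, A₂.step q.2 b)

theorem runFrom_prodStep (x : Word B) (i : ℕ) :
    runFrom (prodStep A₁ A₂) (A₁.start, A₂.start) x i =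
      (runFrom A₁.step A₁.start x i, runFrom A₂.step A₂.start x i) := by
  induction i with
  | zero => rfl
  | succ i ih => simp [runFrom, ih, prodStep]

variable [Finite Q₁] [Finite Q₂]

theorem mem_language_fst {x : Word B} : x ∈ A₁.language ↔ ∃ k, IsGreatest ((fun q => A₁.color q.1) ''
    infSet (runFrom (prodStep A₁ A₂) (A₁.start, A₂.start) x)) k ∧ Odd k := by
  have h := infSet_comp Prod.fst (runFrom (prodStep A₁ A₂) (A₁.start, A₂.start) x)
  simp only [runFrom_prodStep] at h
  change infSet (runFrom A₁.step A₁.start x) = _ at h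
  rw [DPW.language, Set.mem_ofPred_eq, h, Set.image_image]

theorem mem_language_snd {x : Word B} : x ∈ A₂.language ↔ ∃ k, IsGreatest ((fun q => A₂.color q.2) ''
    infSet (runFrom (prodStep A₁ A₂) (A₁.start, A₂.start) x)) k ∧ Odd k := by
  have h := infSet_comp Prod.snd (runFrom (prodStep A₁ A₂) (A₁.start, A₂.start) x)
  simp only [runFrom_prodStep] at h
  change infSet (runFrom A₂.step A₂.start x) = _ at h
  rw [DPW.language, Set.mem_ofPred_eq, h, Set.image_image]

/-- Visiting a vertex outside all loops that are accepting for `A₂` infinitely often separates `A₁`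
from `A₂`, unless a limit set accepting for `A₁` extends to a loop accepting for `A₂`. -/
theorem exists_DBW_or_exists_loop : (∃ D : DBW B (Q₁ × Q₂),
      IsSeparator D.language A₁.language A₂.language) ∨
    ∃ x ∈ A₁.language, ∃ T, infSet (runFrom (prodStep A₁ A₂) (A₁.start, A₂.start) x) ⊆ T ∧
      IsLoop (prodStep A₁ A₂) T ∧ ∃ k, IsGreatest ((fun q => A₂.color q.2) '' T) k ∧ Odd k := by
  let D : DBW B (Q₁ × Q₂) :=
    { start := (A₁.start, A₂.start)
      step := prodStep A₁ A₂
      acc := {q | ¬ ∃ T, IsLoop (prodStep A₁ A₂) T ∧ q ∈ T ∧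
        ∃ k, IsGreatest ((fun q => A₂.color q.2) '' T) k ∧ Odd k} }
  by_cases h : A₁.language ⊆ D.language
  · refine Or.inl ⟨D, h, ?_⟩
    rw [Set.eq_empty_iff_forall_notMem]
    rintro x ⟨h₂, q, hq, hinf⟩
    exact hq ⟨_, isLoop_infSet _ _ x, hinf, (mem_language_snd A₁ A₂).1 h₂⟩
  · obtain ⟨x, hx, hD⟩ := Set.not_subset.1 h
    refine Or.inr ⟨x, hx, (isLoop_infSet _ _ x).exists_superset ?_ fun q hq => ?_⟩
    · obtain ⟨k, ⟨⟨q, hq, -⟩, -⟩, -⟩ := (mem_language_fst A₁ A₂).1 hx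
      exact ⟨q, hq⟩
    · by_contra hc
      exact hD ⟨q, hc, hq⟩

open Classical in
theorem exists_refuter_of_loop {x : Word B} (hx : x ∈ A₁.language) {T : Set (Q₁ × Q₂)}
    (hxT : infSet (runFrom (prodStep A₁ A₂) (A₁.start, A₂.start) x) ⊆ T)
    (hT : IsLoop (prodStep A₁ A₂) T)
    (hT' : ∃ k, IsGreatest ((fun q => A₂.color q.2) '' T) k ∧ Odd k) :
    ∃ R : Transducer Ann B ((Q₁ × Q₂) × Bool), IsDBWSepRefuter R A₁.language A₂.language := by
  have : Nonempty B := ⟨x 0⟩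
  obtain ⟨_, ⟨⟨s₁, h₁, rfl⟩, hmax₁⟩, hodd₁⟩ := (mem_language_fst A₁ A₂).1 hx
  obtain ⟨_, ⟨⟨s₂, h₂, rfl⟩, hmax₂⟩, hodd₂⟩ := hT'
  set δ := prodStep A₁ A₂
  set q₀ := (A₁.start, A₂.start)
  set S := infSet (runFrom δ q₀ x)
  -- `U` adds to `T` the path by which `x` leads from `q₀` to `S`; both targets are reachable from
  -- all of `U` without leaving it.
  let U := Set.range (runFrom δ q₀ x) ∪ T
  have hTU : T ⊆ U := Set.subset_union_right
  have hS : IsLoop δ S := isLoop_infSet _ _ x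
  have hU₁ : ∀ q ∈ U, TransGen (stepIn δ U) q s₁ := by
    rintro q (⟨i, rfl⟩ | hq)
    · obtain ⟨j, hj, hs⟩ := frequently_atTop.1 h₁ (i + 1)
      exact hs ▸ transGen_runFrom hj fun k _ => Or.inl ⟨k, rfl⟩
    · exact transGen_stepIn_mono hTU (hT q hq s₁ (hxT h₁))
  have hU₂ : ∀ q ∈ U, TransGen (stepIn δ U) q s₂ := fun q hq =>
    (hU₁ q hq).trans (transGen_stepIn_mono hTU (hT s₁ (hxT h₁) s₂ h₂))
  obtain ⟨a, da, ha⟩ := exists_steers fun q hq => hS q hq s₁ h₁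
  obtain ⟨b, db, hb⟩ := exists_steers fun q hq => hT q hq s₁ (hxT h₁)
  obtain ⟨c, dc, hc⟩ := exists_steers hU₁
  obtain ⟨b', db', hb'⟩ := exists_steers fun q hq => hT q hq s₂ h₂
  obtain ⟨c', dc', hc'⟩ := exists_steers hU₂
  obtain ⟨d₁, hab⟩ := ha.piecewise hb hxT
  obtain ⟨d₂, habc⟩ := hab.piecewise hc hTU
  obtain ⟨d₃, hbc'⟩ := hb'.piecewise hc' hTU
  -- Inner sets take precedence: both modes preserve `T`, and mode `false` also preserves `S`.
  let g : Bool → Q₁ × Q₂ → B := fun m =>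
    if m then T.piecewise b' c' else T.piecewise (S.piecewise a b) c
  have hgU : ∀ m, ∀ q ∈ U, δ q (g m q) ∈ U := by
    rintro (_ | _) q hq
    · exact (habc q hq).1
    · exact (hbc' q hq).1
  have hgT : ∀ m, ∀ q ∈ T, δ q (g m q) ∈ T := by
    rintro (_ | _) q hq
    · simpa [g, hq] using (hab q hq).1
    · simpa [g, hq] using (hb' q hq).1
  have hgS : ∀ q ∈ S, δ q (g false q) ∈ S := by
    intro q hq
    simpa [g, hq, hxT hq] using (ha q hq).1
  obtain ⟨start, step, hrun⟩ := exists_initialized_modeStep δ q₀ s₂ g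
  refine ⟨⟨Initiator.env, start, step, fun s => g s.2 s.1⟩, rfl, fun y => ?_⟩
  obtain ⟨h0, hs⟩ := hrun y
  refine ⟨_, y, rfl, ?_⟩
  set x' : Word B := fun i => g (runFrom step start y (i + 1)).2 (runFrom step start y (i + 1)).1
  change (x' ∈ _ ∧ _) ∨ (x' ∈ _ ∧ _)
  let s : ℕ → (Q₁ × Q₂) × Bool := fun i => runFrom step start y (i + 1)
  have hsU : ∀ i, (s i).1 ∈ U := by
    intro i
    induction i with
    | zero => exact Or.inl ⟨0, h0.symm⟩
    | succ i ih =>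
      simp only [s, hs]
      exact hgU _ _ ih
  have hx' : runFrom δ q₀ x' = fun i => (s i).1 := by
    funext i
    induction i with
    | zero => exact h0.symm
    | succ i ih =>
      rw [runFrom, ih]
      simp only [s, hs]
      rfl
  -- The initializing move consumes `y 0`, so the strategy sees only the tail of `y`.
  have hshift : (fun i => y (i + 1)) ∈ infAcc ↔ y ∈ infAcc := by
    simp only [infAcc, Set.mem_ofPred_eq, frequently_atTop]
    constructor
    · intro h N
      obtain ⟨i, hi, ha⟩ := h N
      exact ⟨i + 1, by omega, ha⟩
    · intro h N
      obtain ⟨i, hi, ha⟩ := h (N + 1)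
      obtain ⟨i, rfl⟩ : ∃ k, i = k + 1 := ⟨i - 1, by omega⟩
      exact ⟨i, by omega, ha⟩
  by_cases hy : y ∈ infAcc
  · refine Or.inr ⟨(mem_language_snd A₁ A₂).2 ⟨_, ?_, hodd₂⟩, hy⟩
    obtain ⟨hv, hsub⟩ := mode_infAcc (s := s) (y := fun i => y (i + 1)) hs hsU hgT h₂ hbc'
      (hshift.2 hy)
    rw [← hx'] at hv hsub
    exact isGreatest_image_of_subset hv hsub hmax₂
  · refine Or.inl ⟨(mem_language_fst A₁ A₂).2 ⟨_, ?_, hodd₁⟩, hy⟩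
    obtain ⟨hv, hsub⟩ := mode_not_infAcc (s := s) (y := fun i => y (i + 1)) hs hsU hgS h₁ hbc' habc
      (mt hshift.1 hy)
    rw [← hx'] at hv hsub
    exact isGreatest_image_of_subset (c := fun q => A₁.color q.1) hv hsub hmax₁

end Product

/-- The bit is idle padding that brings the DBW to the same number of states as the refuter. -/
theorem exists_DBW_of_equiv {B S S' : Type*} [Finite S] (e : S × Bool ≃ S') (D : DBW B S) :
    ∃ D' : DBW B S', D'.language = D.language := by
  let δ : S × Bool → B → S × Bool := fun s a => (D.step s.1 a, s.2)
  refine ⟨⟨e (D.start, false), fun s a => e (δ (e.symm s) a), {s | (e.symm s).1 ∈ D.acc}⟩, ?_⟩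
  have hfst : ∀ x i, (runFrom δ (D.start, false) x i).1 = runFrom D.step D.start x i := by
    intro x i
    induction i with
    | zero => rfl
    | succ i ih => simp [runFrom, δ, ih]
  have : Finite S' := Finite.of_equiv _ e
  ext x
  have h := infSet_comp (fun s => (e.symm s).1)
    (runFrom (fun s a => e (δ (e.symm s) a)) (e (D.start, false)) x)
  simp only [runFrom_equiv, Equiv.symm_apply_apply, hfst] at h
  change infSet (runFrom D.step D.start x) = _ at h
  simp only [DBW.language, Set.mem_ofPred_eq, h]
  constructor
  · rintro ⟨s, hs, hi⟩
    exact ⟨_, hs, s, by simpa only [← runFrom_equiv] using hi, rfl⟩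
  · rintro ⟨_, hs, s, hi, rfl⟩
    exact ⟨s, hs, by simpa only [← runFrom_equiv] using hi⟩

theorem exists_refuter_of_equiv {B S S' : Type*} (e : S ≃ S') {L₁ L₂ : Lang B}
    (R : Transducer Ann B S) (hR : IsDBWSepRefuter R L₁ L₂) :
    ∃ R' : Transducer Ann B S', IsDBWSepRefuter R' L₁ L₂ := by
  refine ⟨⟨R.init, e R.start, fun s a => e (R.step (e.symm s) a), fun s => R.out (e.symm s)⟩,
    hR.1, fun y => ?_⟩
  have h := hR.2 y
  simpa only [Transducer.annotation, hR.1, runFrom_equiv, Equiv.symm_apply_apply] using h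

end OmegaAut

theorem mainTheorem6 {B : Type*} [Finite B] {Q₁ Q₂ : Type*} [Fintype Q₁] [Fintype Q₂]
    (n₁ n₂ : ℕ) (hn₁ : Fintype.card Q₁ = n₁) (hn₂ : Fintype.card Q₂ = n₂)
    (A₁ : OmegaAut.DPW B Q₁) (A₂ : OmegaAut.DPW B Q₂) :
    (∃ D : OmegaAut.DBW B (Fin (2 * n₁ * n₂)),
        OmegaAut.IsSeparator D.language A₁.language A₂.language) ∨
      (∃ T : OmegaAut.Transducer OmegaAut.Ann B (Fin (2 * n₁ * n₂)),
        OmegaAut.IsDBWSepRefuter T A₁.language A₂.language) := by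
  have e : (Q₁ × Q₂) × Bool ≃ Fin (2 * n₁ * n₂) := Fintype.equivFinOfCardEq (by
    simp only [Fintype.card_prod, Fintype.card_bool, hn₁, hn₂]
    ring)
  rcases OmegaAut.exists_DBW_or_exists_loop A₁ A₂ with ⟨D, hD⟩ | ⟨x, hx, T, hxT, hT, hT'⟩
  · obtain ⟨D', hD'⟩ := OmegaAut.exists_DBW_of_equiv e D
    exact Or.inl ⟨D', hD' ▸ hD⟩
  · obtain ⟨R, hR⟩ := OmegaAut.exists_refuter_of_loop A₁ A₂ hx hxT hT hT'
    exact Or.inr (OmegaAut.exists_refuter_of_equiv e R hR)
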